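/- **Model.** Let $e_{\max},h_{\max},b_{\max}\in\mathbb N$. An energy harvesting device has battery levels $\mathcal E=\{0,\dots,e_{\max}\}$ and channel states $\mathcal H=\{0,\dots,h_{\max}\}$. In slot $k$ the state is $S_k=(E_k,H_k)\in\mathcal E\times\mathcal H$. The device chooses a transmit power $P_k\in\{0,\dots,E_k\}$ drawn from the battery and a power-splitting parameter $I_k\in[0,1]$. It then harvests $B_k\in\mathcal B=\{0,\dots,b_{\max}\}$, which is unknown at the time of the choice, and receives the reward $g(P_k+B_kI_k,H_k)$. For every $h\in\mathcal H$, the function $g(\cdot,h)$ is increasing (possibly not strictly) and concave on $[0,\infty)$. The $B_k$ are i.i.d. with pmf $p_B$ and the $H_k$ ($k\ge 1$) are i.i.d. with pmf $p_H$; they are independent of each other, $B_k$ is independent of $S_0,\dots,S_k$ and of the actions up to slot $k$, and $H_{k+1}$ is independent of everything up to and including slot $k$. The storage efficiency at charge $y$ is $s(y)\in[0,1]$ for $y\in[0,e_{\max}]$, and $s$ is extended to $\mathbb R$ by its values at the end points. With energies measured in quanta and the slot length equal to $1$, let $y_T(x,y_0)=y_1$ be the final charge of the battery evolution $$y_t=y_0+\int_0^t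 x\,s(y_\tau)\,d\tau,\qquad t\in[0,1],$$ which is assumed to have exactly one solution for every $y_0\in\mathcal E$ and every $x\in[-y_0,b_{\max}]$. The battery level evolves as $$E_{k+1}=\min\{\mathrm{Round}\big(y_T((1-I_k)B_k-P_k,\,E_k)\big),\,e_{\max}\},$$ where $\mathrm{Round}$ is rounding to the nearest integer, with halves rounded up. A policy $\mu$ assigns to each state $(e,h)$ a probability measure $f(\cdot\,;e,h)$ on $\{0,\dots,e\}\times[0,1]$, according to which $(P_k,I_k)$ is drawn whenever $S_k=(e,h)$. Its long-term average reward from the initial state $S_0$ is $$G_\mu(S_0)=\liminf_{K\to\infty}\frac1K\,\mathbb E\Big[\sum_{k=0}^{K-1}g(P_k+B_kI_k,H_k)\,\Big|\,S_0\Big].$$ **Theorem.** There is an optimal policy that is deterministic. That is, for every battery level $e\in\mathcal E$ and channel state $h\in\mathcal H$ there is an action pair $(\rho^\star,\iota^\star)\in\{0,\dots,e\}\times[0,1]$, depending only on $(e,h)$, such that the policy $\mu^\star$ that chooses this pair with probability one in each state $(e,h)$ satisfies $G_{\mu}(S_0)\le G_{\mu^\star}(S_0)$ for every policy $\mu$ and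 every initial state $S_0$. -/

import Mathlib

open MeasureTheory

noncomputable section

/-- The data of an energy harvesting device with a lossy battery.  Energies are measured in energy
quanta and the slot length is the unit of time, so that a constant power and the energy it
delivers during one slot have the same numerical value. -/
structure HarvestingDevice where
  /-- Battery size: the battery levels are `0, …, eMax`. -/
  eMax : ℕ
  /-- The channel states are `0, …, hMax`. -/
  hMax : ℕ
  /-- The energy arrivals take the values `0, …, bMax`. -/
  bMax : ℕ
  /-- Storage efficiency as a function of the state of charge; only its values on `[0, eMax]`
  are ever used. -/
  s : ℝ → ℝ
  /-- Reward `g ρ h` of transmitting with power `ρ` in the channel state `h`. -/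
  g : ℝ → Fin (hMax + 1) → ℝ
  /-- Probability mass function of the energy arrivals. -/
  pB : Fin (bMax + 1) → ℝ
  /-- Probability mass function of the channel state. -/
  pH : Fin (hMax + 1) → ℝ

namespace HarvestingDevice

variable (D : HarvestingDevice)

/-- Efficiency at the charge `y`.  Charges beyond the ends of `[0, eMax]` are treated like the
nearest end; this has no effect on the battery level, which is truncated at `eMax`. -/
def efficiency (y : ℝ) : ℝ := D.s (max 0 (min y D.eMax))

/-- `y` is a possible evolution of the charge during one slot (the time interval `[0, 1]`), when
the charge at the beginning is `y₀` and the constant net power fed to the battery is `x`: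
`y t = y₀ + ∫₀ᵗ x s(y τ) dτ`. -/
structure IsCharging (x y₀ : ℝ) (y : ℝ → ℝ) : Prop where
  integrable : IntervalIntegrable (fun τ => D.efficiency (y τ)) volume 0 1
  eq : ∀ t ∈ Set.Icc (0 : ℝ) 1, y t = y₀ + ∫ τ in (0 : ℝ)..t, x * D.efficiency (y τ)

/-- The charging equation determines the charge during a slot, for each initial level `e` and each
net power in `[-e, bMax]`, the range of `(1 - ι) b - ρ`. -/
def WellPosed : Prop :=
  ∀ e : Fin (D.eMax + 1), ∀ x ∈ Set.Icc (-(e : ℝ)) (D.bMax : ℝ),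
    (∃ y, D.IsCharging x e y) ∧
      ∀ y y', D.IsCharging x e y → D.IsCharging x e y' → Set.EqOn y y' (Set.Icc 0 1)

open Classical in
/-- The charge at the end of a slot (`y₀` by convention if the charging equation has no
solution). -/
def finalCharge (x y₀ : ℝ) : ℝ :=
  if hy : ∃ y, D.IsCharging x y₀ y then hy.choose 1 else y₀

/-- States of the system: battery level and channel state. -/
abbrev State : Type := Fin (D.eMax + 1) × Fin (D.hMax + 1)

/-- Actions at battery level `e`: a transmit power `ρ ∈ {0, …, e}` and a power splitting
parameter `ι ∈ [0, 1]`. -/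
abbrev Action (e : Fin (D.eMax + 1)) : Type := Fin ((e : ℕ) + 1) × Set.Icc (0 : ℝ) 1

variable {D}

/-- Battery level after a slot with initial level `e`, action `a = (ρ, ι)` and energy arrival `b`:
the rounded final charge, truncated at `eMax`. -/
def nextLevel (e : Fin (D.eMax + 1)) (a : D.Action e) (b : Fin (D.bMax + 1)) :
    Fin (D.eMax + 1) :=
  ⟨(min (round (D.finalCharge ((1 - (a.2 : ℝ)) * (b : ℝ) - ((a.1 : ℕ) : ℝ)) (e : ℝ)))
      (D.eMax : ℤ)).toNat, by omega⟩

variable (D)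

/-- A (stationary, randomized) policy: for each state, the joint law of the transmit power and of
the power splitting parameter. -/
abbrev Policy : Type := ∀ st : D.State, ProbabilityMeasure (D.Action st.1)

variable {D}

/-- The policy that in the state `st` chooses the pair `(ρ st, ι st)` with probability one. -/
def deterministicPolicy (ρ : ∀ st : D.State, Fin ((st.1 : ℕ) + 1))
    (ι : D.State → Set.Icc (0 : ℝ) 1) : D.Policy :=
  fun st => ⟨Measure.dirac (ρ st, ι st), inferInstance⟩

/-- Transition probabilities of the Markov chain induced by `μ`.  The energy arrival is independent
of the action, and the next channel state is independent of everything before it. -/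
def transitionProb (μ : D.Policy) (st st' : D.State) : ℝ :=
  (∑ b, D.pB b * (μ st : Measure (D.Action st.1)).real {a | nextLevel st.1 a b = st'.1}) *
    D.pH st'.2

/-- `stateLaw μ s₀ k st` is the probability that the state in slot `k` is `st`, given that the
state in slot `0` is `s₀`. -/
def stateLaw (μ : D.Policy) (s₀ : D.State) : ℕ → D.State → ℝ
  | 0 => fun st => if st = s₀ then 1 else 0
  | k + 1 => fun st' => ∑ st, stateLaw μ s₀ k st * transitionProb μ st st'

/-- Expected reward of a slot given that its state is `st = (e, h)`: the expectation of
`g (ρ + b ι) h` over the energy arrival `b` and the action `(ρ, ι)`. -/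
def slotReward (μ : D.Policy) (st : D.State) : ℝ :=
  ∑ b, D.pB b *
    ∫ a, D.g (((a.1 : ℕ) : ℝ) + (b : ℝ) * (a.2 : ℝ)) st.2 ∂(μ st : Measure (D.Action st.1))

/-- Expected reward of slot `k` given the initial state `s₀`. -/
def expectedReward (μ : D.Policy) (s₀ : D.State) (k : ℕ) : ℝ :=
  ∑ st, stateLaw μ s₀ k st * slotReward μ st

/-- Long-term average reward of the policy `μ` from the initial state `s₀`. -/
def averageReward (μ : D.Policy) (s₀ : D.State) : ℝ :=
  Filter.liminf (fun K : ℕ => (1 / (K : ℝ)) * ∑ k ∈ Finset.range K, expectedReward μ s₀ k)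
    Filter.atTop

end HarvestingDevice

end

/-! The proof combines an argument on finite-state decision processes with a reduction of the
continuum of actions to finitely many.

Decision processes: suppose a finite set of policies suffices to maximize every one-step lookahead.
Then for each discount factor `β < 1` some member is discounted optimal, and by pigeonhole one
member is so along a sequence `β → 1`. Splitting the reward as `R = r + (w - P w)` with `P r = r`
identifies the average reward as `r`, and for a policy's own discounted value `v` it shows that `(1
- β) v` is within `2 (1 - β) ‖w‖` of `r`. Optimality therefore survives the limit
(`exists_average_optimal`). No irreducibility is needed, so a single policy serves all initial
states.

Finite reduction: for fixed `ρ`, raising `ι` raises the reward and can only lower the next battery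
levels, which take finitely many values. So `ι` may be pushed to the largest value that keeps those
levels. It exists because the final charge is continuous in the net power and halves are rounded up
(`exists_finite_splitting`). The regularity of the final charge comes from rescaling time: the
evolution for power `c x` is the one for `x` run at speed `c`. Randomizing does not help, since it
only averages lookaheads (`integral_lookahead`). -/

section MarkovDecision

open Filter Topology Matrix

variable {S : Type*} [Fintype S] [DecidableEq S] {P : Matrix S S ℝ}

/-! ### Long-run averages of powers of a stochastic matrix. -/

lemma mulVec_const_of_mem_rowStochastic (hP : P ∈ rowStochastic ℝ S) (c : ℝ) (i : S) :
    (P *ᵥ fun _ => c) i = c := by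
  simp only [mulVec, dotProduct, ← Finset.sum_mul, sum_row_of_mem_rowStochastic hP, one_mul]

lemma mulVec_mono_of_mem_rowStochastic (hP : P ∈ rowStochastic ℝ S) {x y : S → ℝ}
    (h : ∀ j, x j ≤ y j) (i : S) : (P *ᵥ x) i ≤ (P *ᵥ y) i :=
  Finset.sum_le_sum fun j _ =>
    mul_le_mul_of_nonneg_left (h j) (nonneg_of_mem_rowStochastic hP)

lemma norm_mulVec_le_of_mem_rowStochastic (hP : P ∈ rowStochastic ℝ S) (x : S → ℝ) :
    ‖P *ᵥ x‖ ≤ ‖x‖ := by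
  refine (pi_norm_le_iff_of_nonneg (norm_nonneg x)).2 fun i => ?_
  rw [Real.norm_eq_abs, abs_le]
  have hx := fun j => abs_le.1 ((Real.norm_eq_abs (x j)).symm.le.trans (norm_le_pi_norm x j))
  constructor
  · simpa only [mulVec_const_of_mem_rowStochastic hP] using
      mulVec_mono_of_mem_rowStochastic hP (x := fun _ => -‖x‖) (fun j => (hx j).1) i
  · simpa only [mulVec_const_of_mem_rowStochastic hP] using
      mulVec_mono_of_mem_rowStochastic hP (y := fun _ => ‖x‖) (fun j => (hx j).2) i

/-- The invariant part contributes `r` in every step, while the coboundary part telescopes. -/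
lemma sum_pow_mulVec (P : Matrix S S ℝ) {R r w : S → ℝ} (hr : P *ᵥ r = r)
    (hR : R = r + (w - P *ᵥ w)) (K : ℕ) :
    ∑ k ∈ Finset.range K, P ^ k *ᵥ R = (K : ℝ) • r + (w - P ^ K *ᵥ w) := by
  have hpow : ∀ k, P ^ k *ᵥ r = r := fun k => by
    induction k with
    | zero => simp
    | succ k ih => rw [pow_succ, ← mulVec_mulVec, hr, ih]
  induction K with
  | zero => simp
  | succ K ih =>
    rw [Finset.sum_range_succ, ih, hR, mulVec_add, mulVec_sub, hpow, mulVec_mulVec, ← pow_succ]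
    push_cast
    rw [add_smul, one_smul]
    abel

/-- Every vector is the sum of an invariant vector and a coboundary of a stochastic matrix. -/
theorem exists_invariant_add_coboundary (hP : P ∈ rowStochastic ℝ S) (R : S → ℝ) :
    ∃ r w : S → ℝ, P *ᵥ r = r ∧ R = r + (w - P *ᵥ w) := by
  set f : (S → ℝ) →ₗ[ℝ] (S → ℝ) := LinearMap.id - P.mulVecLin with hf
  have hfx : ∀ x, f x = x - P *ᵥ x := fun x => rfl
  -- If `f w` is invariant, its orbit sum is both `K • f w` and the telescoped `w - P ^ K w`. The
  -- latter has norm at most `2 ‖w‖`, which is impossible for large `K` unless `f w = 0`.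
  have hdisj : Disjoint (LinearMap.ker f) (LinearMap.range f) := by
    rw [Submodule.disjoint_def]
    rintro z hz ⟨w, rfl⟩
    rw [LinearMap.mem_ker, hfx, sub_eq_zero] at hz
    by_contra hne
    have hpos : 0 < ‖f w‖ := norm_pos_iff.2 hne
    obtain ⟨K, hK⟩ := exists_nat_gt (2 * ‖w‖ / ‖f w‖)
    rw [div_lt_iff₀ hpos] at hK
    have hsum := sum_pow_mulVec P (R := f w) (r := 0) (w := w) (by simp) (by simp [hfx]) K
    have hsum' := sum_pow_mulVec P (R := f w) (r := f w) (w := 0) hz.symm (by simp) K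
    rw [hsum] at hsum'
    have heq : (K : ℝ) • f w = w - P ^ K *ᵥ w := by simpa using hsum'.symm
    have h1 : ‖(K : ℝ) • f w‖ = K * ‖f w‖ := by simp [norm_smul]
    have h2 := norm_sub_le w (P ^ K *ᵥ w)
    have h3 := norm_mulVec_le_of_mem_rowStochastic (pow_mem hP K) w
    rw [← heq, h1] at h2
    linarith
  -- Kernel and range have complementary dimensions by rank-nullity, so disjointness suffices.
  have hcompl : IsCompl (LinearMap.ker f) (LinearMap.range f) := by
    refine (Submodule.isCompl_iff_disjoint _ _ ?_).2 hdisj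
    rw [add_comm, LinearMap.finrank_range_add_finrank_ker]
  have hmem : R ∈ LinearMap.ker f ⊔ LinearMap.range f := by
    rw [hcompl.sup_eq_top]; trivial
  obtain ⟨r, hr, _, ⟨w, rfl⟩, hsum⟩ := Submodule.mem_sup.1 hmem
  rw [LinearMap.mem_ker, hfx, sub_eq_zero] at hr
  exact ⟨r, w, hr.symm, hsum.symm⟩

/-- The telescoped remainder stays bounded by `2 ‖w‖`, so dividing by `K` removes it. In particular
the liminf defining the average reward is a limit. -/
theorem tendsto_average_pow_mulVec (hP : P ∈ rowStochastic ℝ S) {R r w : S → ℝ}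
    (hr : P *ᵥ r = r) (hR : R = r + (w - P *ᵥ w)) (i : S) :
    Tendsto (fun K : ℕ => (1 / (K : ℝ)) * ∑ k ∈ Finset.range K, (P ^ k *ᵥ R) i) atTop
      (𝓝 (r i)) := by
  have hbound : Tendsto (fun K : ℕ => (1 / (K : ℝ)) * (w i - (P ^ K *ᵥ w) i)) atTop (𝓝 0) := by
    have h0 : Tendsto (fun K : ℕ => (1 / (K : ℝ)) * (2 * ‖w‖)) atTop (𝓝 0) := by
      simpa using tendsto_one_div_atTop_nhds_zero_nat.mul_const (2 * ‖w‖)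
    refine squeeze_zero_norm (fun K => ?_) h0
    rw [norm_mul, Real.norm_of_nonneg (by positivity : (0 : ℝ) ≤ 1 / K)]
    refine mul_le_mul_of_nonneg_left ?_ (by positivity)
    have h1 := norm_le_pi_norm (w - P ^ K *ᵥ w) i
    have h2 := norm_sub_le w (P ^ K *ᵥ w)
    have h3 := norm_mulVec_le_of_mem_rowStochastic (pow_mem hP K) w
    rw [Pi.sub_apply] at h1
    linarith
  have hlim : Tendsto (fun K : ℕ => r i + (1 / (K : ℝ)) * (w i - (P ^ K *ᵥ w) i)) atTop
      (𝓝 (r i)) := by simpa using hbound.const_add (r i)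
  refine hlim.congr' ?_
  filter_upwards [eventually_gt_atTop 0] with K hK
  have hK' : (K : ℝ) ≠ 0 := by positivity
  have hsum := congrFun (sum_pow_mulVec P hr hR K) i
  simp only [Finset.sum_apply, Pi.add_apply, Pi.sub_apply, Pi.smul_apply, smul_eq_mul] at hsum
  rw [hsum]
  field_simp

/-! ### Discounted values and the vanishing discount limit. -/

lemma neg_le_of_discounted_supersolution (hP : P ∈ rowStochastic ℝ S) {β C : ℝ} (hβ0 : 0 ≤ β)
    (hβ1 : β < 1) {u : S → ℝ} (hu : ∀ i, β * (P *ᵥ u) i - (1 - β) * C ≤ u i) (i : S) :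
    -C ≤ u i := by
  have : Nonempty S := ⟨i⟩
  -- Minimum principle: averaging by `P` cannot go below the minimum, so at a minimizer the
  -- inequality reads `(1 - β) u m ≥ -(1 - β) C`.
  obtain ⟨m, hm⟩ := Finite.exists_min u
  have h1 : u m ≤ (P *ᵥ u) m := by
    simpa only [mulVec_const_of_mem_rowStochastic hP] using
      mulVec_mono_of_mem_rowStochastic hP (x := fun _ => u m) hm m
  have h2 := mul_le_mul_of_nonneg_left h1 hβ0
  have h3 := hu m
  have h4 : (1 - β) * (-C) ≤ (1 - β) * u m := by linarith
  exact (le_of_mul_le_mul_left h4 (by linarith)).trans (hm i)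

/-- A supersolution of the discounted value equation is bounded below by the average reward divided
by one minus the discount factor, up to a constant. -/
theorem le_discounted_supersolution (hP : P ∈ rowStochastic ℝ S) {R r w : S → ℝ}
    (hr : P *ᵥ r = r) (hR : R = r + (w - P *ᵥ w)) {β : ℝ} (hβ0 : 0 ≤ β) (hβ1 : β < 1)
    {v : S → ℝ} (hv : ∀ i, R i + β * (P *ᵥ v) i ≤ v i) (i : S) :
    r i ≤ (1 - β) * v i + (1 - β) * (2 * ‖w‖) := by
  have hne : (1 - β) ≠ 0 := by linarith
  -- The vector `r / (1 - β) + w` solves the discounted equation for `R` up to the error `(1 - β) P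
  -- w`, whence `C = ‖w‖`.
  have key := neg_le_of_discounted_supersolution hP (C := ‖w‖)
    (u := v - (1 / (1 - β)) • r - w) hβ0 hβ1 (fun j => ?_) i
  · have hw := norm_le_pi_norm w i
    rw [Real.norm_eq_abs] at hw
    have hw' := (abs_le.1 hw).1
    simp only [Pi.sub_apply, Pi.smul_apply, smul_eq_mul] at key
    have h5 : (1 - β) * ((1 / (1 - β)) * r i) = r i := by field_simp
    have h6 : (1 / (1 - β)) * r i ≤ v i + 2 * ‖w‖ := by linarith
    have := mul_le_mul_of_nonneg_left h6 (by linarith : 0 ≤ 1 - β)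
    linarith
  · have h1 := hv j
    have hw := (norm_le_pi_norm (P *ᵥ w) j).trans (norm_mulVec_le_of_mem_rowStochastic hP w)
    rw [Real.norm_eq_abs] at hw
    have hw' := mul_le_mul_of_nonneg_left (abs_le.1 hw).2 (by linarith : 0 ≤ 1 - β)
    rw [hR] at h1
    simp only [mulVec_sub, mulVec_smul, hr, Pi.sub_apply, Pi.add_apply, Pi.smul_apply,
      smul_eq_mul] at h1 ⊢
    have h5 : (1 / (1 - β)) * r j = r j + β * ((1 / (1 - β)) * r j) := by field_simp; ring
    linarith

/-- The supersolution bound applied to the negatives of `R`, `r`, `w` and `v`. -/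
theorem discounted_subsolution_le (hP : P ∈ rowStochastic ℝ S) {R r w : S → ℝ}
    (hr : P *ᵥ r = r) (hR : R = r + (w - P *ᵥ w)) {β : ℝ} (hβ0 : 0 ≤ β) (hβ1 : β < 1)
    {v : S → ℝ} (hv : ∀ i, v i ≤ R i + β * (P *ᵥ v) i) (i : S) :
    (1 - β) * v i ≤ r i + (1 - β) * (2 * ‖w‖) := by
  have := le_discounted_supersolution hP (R := -R) (r := -r) (w := -w) (v := -v)
    (by rw [mulVec_neg, hr]) (by rw [hR, mulVec_neg]; abel) hβ0 hβ1
    (fun j => by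
      have := hv j
      simp only [mulVec_neg, Pi.neg_apply]
      linarith) i
  simp only [Pi.neg_apply, norm_neg] at this
  linarith

/-- The optimality equation of discounted dynamic programming has a solution. -/
theorem exists_bellman_fixedPoint {M : Type*} (R : M → S → ℝ) (P : M → Matrix S S ℝ)
    (hP : ∀ μ, P μ ∈ rowStochastic ℝ S) (F : Set M)
    (hF : ∀ v : S → ℝ, ∃ d ∈ F, ∀ μ i, R μ i + (P μ *ᵥ v) i ≤ R d i + (P d *ᵥ v) i)
    {β : ℝ} (hβ0 : 0 ≤ β) (hβ1 : β < 1) :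
    ∃ v : S → ℝ, ∃ d ∈ F, (∀ i, v i = R d i + β * (P d *ᵥ v) i) ∧
      ∀ μ i, R μ i + β * (P μ *ᵥ v) i ≤ v i := by
  choose δ hδF hδ using hF
  -- The Bellman operator: `δ (β • v)` is greedy for the continuation value `β • v`.
  set T : (S → ℝ) → S → ℝ := fun v => R (δ (β • v)) + P (δ (β • v)) *ᵥ (β • v) with hT
  -- The decision greedy for `v` is merely admissible for `v'`. Using it in both makes the rewards
  -- cancel and leaves `β P (v - v')`.
  have hTle : ∀ v v' i, T v i - T v' i ≤ β * ‖v - v'‖ := fun v v' i => by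
    have h1 := hδ (β • v') (δ (β • v)) i
    have h2 := (norm_le_pi_norm (P (δ (β • v)) *ᵥ (v - v')) i).trans
      (norm_mulVec_le_of_mem_rowStochastic (hP _) _)
    have h3 := mul_le_mul_of_nonneg_left ((le_abs_self _).trans h2) hβ0
    simp only [hT, Pi.add_apply, mulVec_smul, mulVec_sub, Pi.smul_apply, Pi.sub_apply,
      smul_eq_mul] at h1 h3 ⊢
    linarith
  have hcontr : ContractingWith ⟨β, hβ0⟩ T := by
    refine ⟨by exact_mod_cast hβ1, LipschitzWith.of_dist_le_mul fun v v' => ?_⟩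
    change dist (T v) (T v') ≤ β * dist v v'
    rw [dist_eq_norm, dist_eq_norm]
    refine (pi_norm_le_iff_of_nonneg (by positivity)).2 fun i => ?_
    rw [Pi.sub_apply, Real.norm_eq_abs, abs_le]
    have h1 := hTle v v' i
    have h2 := hTle v' v i
    rw [norm_sub_rev] at h2
    constructor <;> linarith
  have hfix : T (hcontr.fixedPoint T) = hcontr.fixedPoint T := hcontr.fixedPoint_isFixedPt
  set v := hcontr.fixedPoint T
  have hv : ∀ i, v i = R (δ (β • v)) i + β * (P (δ (β • v)) *ᵥ v) i := fun i => by
    conv_lhs => rw [← hfix]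
    simp only [hT, Pi.add_apply, mulVec_smul, Pi.smul_apply, smul_eq_mul]
  refine ⟨v, δ (β • v), hδF _, hv, fun μ i => ?_⟩
  rw [hv i]
  simpa only [mulVec_smul, Pi.smul_apply, smul_eq_mul] using hδ (β • v) μ i

/-- If finitely many stationary policies suffice to maximize every one-step lookahead, then one of
them maximizes the long-term average reward from all initial states. -/
theorem exists_average_optimal {M : Type*} (R : M → S → ℝ) (P : M → Matrix S S ℝ)
    (hP : ∀ μ, P μ ∈ rowStochastic ℝ S) {F : Set M} (hfin : F.Finite)
    (hF : ∀ v : S → ℝ, ∃ d ∈ F, ∀ μ i, R μ i + (P μ *ᵥ v) i ≤ R d i + (P d *ᵥ v) i) :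
    ∃ d ∈ F, ∀ μ i,
      liminf (fun K : ℕ => (1 / (K : ℝ)) * ∑ k ∈ Finset.range K, (P μ ^ k *ᵥ R μ) i) atTop ≤
      liminf (fun K : ℕ => (1 / (K : ℝ)) * ∑ k ∈ Finset.range K, (P d ^ k *ᵥ R d) i) atTop := by
  choose r w hr hR using fun μ => exists_invariant_add_coboundary (hP μ) (R μ)
  have hβ0 : ∀ n : ℕ, 0 ≤ 1 - 1 / ((n : ℝ) + 1) := fun n => by
    rw [sub_nonneg, div_le_one (by positivity)]
    linarith [n.cast_nonneg (α := ℝ)]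
  have hβ1 : ∀ n : ℕ, 1 - 1 / ((n : ℝ) + 1) < 1 := fun n => by
    have : 0 < 1 / ((n : ℝ) + 1) := by positivity
    linarith
  choose v δ hδF hδ hv using fun n =>
    exists_bellman_fixedPoint R P hP F hF (hβ0 n) (hβ1 n)
  have : Finite F := hfin
  -- Pigeonhole: one `d` is discounted optimal for infinitely many of the discount factors `1 - 1 /
  -- (n + 1)`.
  obtain ⟨d, hd⟩ := Finite.exists_infinite_fiber fun n => (⟨δ n, hδF n⟩ : F)
  have hfreq : ∃ᶠ n in atTop, δ n = d := by
    rw [Nat.frequently_atTop_iff_infinite]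
    convert! Set.infinite_coe_iff.1 hd using 1
    ext n
    simp [Subtype.ext_iff]
  refine ⟨d, d.2, fun μ i => ?_⟩
  rw [(tendsto_average_pow_mulVec (hP μ) (hr μ) (hR μ) i).liminf_eq,
    (tendsto_average_pow_mulVec (hP d) (hr d) (hR d) i).liminf_eq]
  have hlim : Tendsto (fun n : ℕ => r d i + 1 / ((n : ℝ) + 1) * (2 * ‖w d‖ + 2 * ‖w μ‖)) atTop
      (𝓝 (r d i)) := by
    simpa using ((tendsto_one_div_add_atTop_nhds_zero_nat (𝕜 := ℝ)).mul_const
      (2 * ‖w d‖ + 2 * ‖w μ‖)).const_add (r d i)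
  refine ge_of_tendsto_of_frequently hlim (hfreq.mono fun n hn => ?_)
  have h1 := le_discounted_supersolution (hP μ) (hr μ) (hR μ) (hβ0 n) (hβ1 n) (hv n μ) i
  have h2 := discounted_subsolution_le (hP d) (hr d) (hR d) (hβ0 n) (hβ1 n)
    (fun j => (hn ▸ hδ n j).le) i
  rw [sub_sub_cancel] at h1 h2
  linarith

end MarkovDecision

/-! ### Dependence of the final charge on the net power. -/

namespace HarvestingDevice

variable {D : HarvestingDevice}

lemma efficiency_mem_Icc (hs : ∀ y ∈ Set.Icc (0 : ℝ) D.eMax, D.s y ∈ Set.Icc (0 : ℝ) 1) (y : ℝ) :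
    D.efficiency y ∈ Set.Icc (0 : ℝ) 1 :=
  hs _ ⟨le_max_left _ _, max_le D.eMax.cast_nonneg (min_le_right _ _)⟩

/-- Slowing down an evolution of the charge yields an evolution for a smaller net power. -/
lemma IsCharging.comp_mul {x y₀ : ℝ} {y : ℝ → ℝ} (hy : D.IsCharging x y₀ y) {c : ℝ}
    (hc : c ∈ Set.Icc (0 : ℝ) 1) : D.IsCharging (c * x) y₀ fun t => y (c * t) where
  integrable := by
    -- The change of variables divides by `c`; for `c = 0` the integrand is constant.
    rcases hc.1.eq_or_lt with rfl | hpos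
    · simp
    · have hsub : IntervalIntegrable (fun τ => D.efficiency (y τ)) volume 0 c :=
        hy.integrable.mono_set (by
          rw [Set.uIcc_of_le hc.1, Set.uIcc_of_le zero_le_one]
          exact Set.Icc_subset_Icc_right hc.2)
      have := hsub.comp_mul_left (c := c)
      rwa [zero_div, div_self hpos.ne'] at this
  eq t ht := by
    have hct : c * t ∈ Set.Icc (0 : ℝ) 1 :=
      ⟨mul_nonneg hc.1 ht.1, mul_le_one₀ hc.2 ht.1 ht.2⟩
    have := intervalIntegral.mul_integral_comp_mul_left (a := 0) (b := t)
      (f := fun τ => x * D.efficiency (y τ)) c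
    rw [mul_zero] at this
    rw [hy.eq _ hct, ← this, ← intervalIntegral.integral_const_mul]
    simp only [mul_assoc]

lemma WellPosed.finalCharge_eq (hwell : D.WellPosed) (e : Fin (D.eMax + 1)) {x : ℝ}
    (hx : x ∈ Set.Icc (-(e : ℝ)) (D.bMax : ℝ)) {y : ℝ → ℝ} (hy : D.IsCharging x e y) :
    D.finalCharge x e = y 1 := by
  have hex : ∃ y, D.IsCharging x e y := ⟨y, hy⟩
  rw [finalCharge, dif_pos hex]
  exact (hwell e x hx).2 _ _ hex.choose_spec hy (Set.right_mem_Icc.2 zero_le_one)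

/-- The final charges for two net powers of the same sign lie on a common evolution. -/
lemma WellPosed.exists_finalCharge_sub (hwell : D.WellPosed)
    (hs : ∀ y ∈ Set.Icc (0 : ℝ) D.eMax, D.s y ∈ Set.Icc (0 : ℝ) 1) (e : Fin (D.eMax + 1)) {x : ℝ}
    (hx : x ∈ Set.Icc (-(e : ℝ)) (D.bMax : ℝ)) {c : ℝ} (hc : c ∈ Set.Icc (0 : ℝ) 1) :
    ∃ q ∈ Set.Icc (0 : ℝ) (1 - c), D.finalCharge x e - D.finalCharge (c * x) e = x * q := by
  obtain ⟨y, hy⟩ := (hwell e x hx).1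
  have hcx : c * x ∈ Set.Icc (-(e : ℝ)) (D.bMax : ℝ) := by
    have he : (0 : ℝ) ≤ (e : ℝ) := Nat.cast_nonneg _
    have hb : (0 : ℝ) ≤ D.bMax := Nat.cast_nonneg _
    constructor <;> nlinarith [hx.1, hx.2, hc.1, hc.2]
  have hsub : ∀ {a b : ℝ}, 0 ≤ a → a ≤ b → b ≤ 1 →
      IntervalIntegrable (fun τ => D.efficiency (y τ)) volume a b := fun ha hab hb =>
    hy.integrable.mono_set (by
      rw [Set.uIcc_of_le hab, Set.uIcc_of_le zero_le_one]
      exact Set.Icc_subset_Icc ha hb)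
  refine ⟨∫ τ in c..1, D.efficiency (y τ), ⟨?_, ?_⟩, ?_⟩
  · exact intervalIntegral.integral_nonneg hc.2 fun τ _ => (efficiency_mem_Icc hs _).1
  · have := intervalIntegral.integral_mono_on hc.2 (hsub hc.1 hc.2 le_rfl)
      (intervalIntegrable_const (c := (1 : ℝ))) fun τ _ => (efficiency_mem_Icc hs (y τ)).2
    simpa using this
  · rw [hwell.finalCharge_eq e hx hy, hwell.finalCharge_eq e hcx (hy.comp_mul hc), mul_one,
      hy.eq 1 (Set.right_mem_Icc.2 zero_le_one), hy.eq c hc,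
      intervalIntegral.integral_const_mul, intervalIntegral.integral_const_mul,
      ← intervalIntegral.integral_add_adjacent_intervals (hsub le_rfl hc.1 hc.2)
        (hsub hc.1 hc.2 le_rfl)]
    ring

/-- For powers of the same sign the difference is the larger power in modulus, with its sign, times
an integral of the efficiency over the remaining time; efficiencies lie in `[0, 1]`. Opposite signs
are joined through power `0`. -/
lemma WellPosed.finalCharge_sub_mem (hwell : D.WellPosed)
    (hs : ∀ y ∈ Set.Icc (0 : ℝ) D.eMax, D.s y ∈ Set.Icc (0 : ℝ) 1) (e : Fin (D.eMax + 1))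
    {x x' : ℝ} (hx : x ∈ Set.Icc (-(e : ℝ)) (D.bMax : ℝ))
    (hx' : x' ∈ Set.Icc (-(e : ℝ)) (D.bMax : ℝ)) (hxx' : x ≤ x') :
    D.finalCharge x' e - D.finalCharge x e ∈ Set.Icc 0 (x' - x) := by
  have hpos : ∀ {x x' : ℝ}, x' ∈ Set.Icc (-(e : ℝ)) (D.bMax : ℝ) → 0 ≤ x → x ≤ x' →
      D.finalCharge x' e - D.finalCharge x e ∈ Set.Icc 0 (x' - x) := by
    intro x x' hx' h0 hle
    rcases (h0.trans hle).eq_or_lt with h | h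
    · obtain rfl : x = x' := by linarith
      simp
    · obtain ⟨q, hq, heq⟩ := hwell.exists_finalCharge_sub hs e hx' (c := x / x')
        ⟨by positivity, (div_le_one h).2 hle⟩
      rw [div_mul_cancel₀ _ h.ne'] at heq
      rw [heq]
      refine ⟨mul_nonneg h.le hq.1, (mul_le_mul_of_nonneg_left hq.2 h.le).trans_eq ?_⟩
      field_simp
  have hneg : ∀ {x x' : ℝ}, x ∈ Set.Icc (-(e : ℝ)) (D.bMax : ℝ) → x' ≤ 0 → x ≤ x' →
      D.finalCharge x' e - D.finalCharge x e ∈ Set.Icc 0 (x' - x) := by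
    intro x x' hx h0 hle
    rcases (hle.trans h0).eq_or_lt with h | h
    · obtain rfl : x = x' := by linarith
      simp
    · obtain ⟨q, hq, heq⟩ := hwell.exists_finalCharge_sub hs e hx (c := x' / x)
        ⟨div_nonneg_of_nonpos h0 h.le, (div_le_one_of_neg h).2 hle⟩
      rw [div_mul_cancel₀ _ h.ne] at heq
      have h1 := mul_nonpos_of_nonpos_of_nonneg h.le hq.1
      have h2 := mul_le_mul_of_nonpos_left hq.2 h.le
      have hne := h.ne
      have h3 : x * (1 - x' / x) = x - x' := by field_simp
      constructor <;> linarith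
  rcases le_total 0 x with h | h
  · exact hpos hx' h hxx'
  rcases le_total x' 0 with h' | h'
  · exact hneg hx h' hxx'
  have h1 := hpos hx' le_rfl h'
  have h2 := hneg hx le_rfl h
  constructor <;> linarith [h1.1, h1.2, h2.1, h2.2]

/-- Net power fed to the battery under the action `a` when the energy `b` arrives. -/
noncomputable def netPower {e : Fin (D.eMax + 1)} (a : D.Action e) (b : Fin (D.bMax + 1)) : ℝ :=
  (1 - (a.2 : ℝ)) * (b : ℝ) - ((a.1 : ℕ) : ℝ)

lemma netPower_mem_Icc {e : Fin (D.eMax + 1)} (a : D.Action e) (b : Fin (D.bMax + 1)) :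
    netPower a b ∈ Set.Icc (-(e : ℝ)) (D.bMax : ℝ) := by
  have h1 : ((a.1 : ℕ) : ℝ) ≤ (e : ℝ) := by exact_mod_cast Nat.lt_succ_iff.1 a.1.2
  have h2 : ((b : ℕ) : ℝ) ≤ (D.bMax : ℝ) := by exact_mod_cast Nat.lt_succ_iff.1 b.2
  have h3 : (0 : ℝ) ≤ ((a.1 : ℕ) : ℝ) := Nat.cast_nonneg _
  have h4 : (0 : ℝ) ≤ ((b : ℕ) : ℝ) := Nat.cast_nonneg _
  have h5 := a.2.2.1
  have h6 := a.2.2.2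
  unfold netPower
  constructor <;> nlinarith

lemma WellPosed.continuous_finalCharge (hwell : D.WellPosed)
    (hs : ∀ y ∈ Set.Icc (0 : ℝ) D.eMax, D.s y ∈ Set.Icc (0 : ℝ) 1) (e : Fin (D.eMax + 1))
    (b : Fin (D.bMax + 1)) :
    Continuous fun a : D.Action e => D.finalCharge (netPower a b) e := by
  have hlip : LipschitzOnWith 1 (fun x => D.finalCharge x e)
      (Set.Icc (-(e : ℝ)) (D.bMax : ℝ)) := by
    refine LipschitzOnWith.of_le_add fun x hx x' hx' => ?_
    rw [Real.dist_eq]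
    rcases le_total x x' with h | h
    · linarith [(hwell.finalCharge_sub_mem hs e hx hx' h).1, abs_nonneg (x - x')]
    · linarith [(hwell.finalCharge_sub_mem hs e hx' hx h).2, le_abs_self (x - x')]
  refine hlip.continuousOn.comp_continuous ?_ fun a => netPower_mem_Icc a b
  unfold netPower
  have : Continuous fun a : D.Action e => ((a.1 : ℕ) : ℝ) :=
    (continuous_of_discreteTopology (f := fun i : Fin ((e : ℕ) + 1) => ((i : ℕ) : ℝ))).comp
      continuous_fst
  fun_prop

/-! ### Rounding to battery levels and the finite set of actions. -/

lemma le_nextLevel_iff {e : Fin (D.eMax + 1)} {a : D.Action e} {b : Fin (D.bMax + 1)}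
    {n : Fin (D.eMax + 1)} :
    n ≤ nextLevel e a b ↔
      (n : ℕ) = 0 ∨ ((n : ℕ) : ℝ) - 1 / 2 ≤ D.finalCharge (netPower a b) e := by
  have hround : ((n : ℕ) : ℤ) ≤ round (D.finalCharge (netPower a b) e) ↔
      ((n : ℕ) : ℝ) - 1 / 2 ≤ D.finalCharge (netPower a b) e := by
    -- Rounding halves up makes the threshold inequality non-strict; this is what makes the
    -- superlevel sets closed.
    rw [round_eq, Int.le_floor, Int.cast_natCast, sub_le_iff_le_add]
  rw [← hround, Fin.le_def]
  have hn := Nat.lt_succ_iff.1 n.2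
  change (n : ℕ) ≤ (min (round (D.finalCharge (netPower a b) e)) (D.eMax : ℤ)).toNat ↔ _
  -- Level `0` is always reached because `toNat` sends negative values to `0`, and truncation is
  -- harmless since `n ≤ eMax`.
  omega

lemma WellPosed.isClosed_le_nextLevel (hwell : D.WellPosed)
    (hs : ∀ y ∈ Set.Icc (0 : ℝ) D.eMax, D.s y ∈ Set.Icc (0 : ℝ) 1) (e : Fin (D.eMax + 1))
    (b : Fin (D.bMax + 1)) (n : Fin (D.eMax + 1)) :
    IsClosed {a : D.Action e | n ≤ nextLevel e a b} := by
  simp only [le_nextLevel_iff, Set.ofPred_or]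
  exact isClosed_const.union
    (isClosed_le continuous_const (hwell.continuous_finalCharge hs e b))

lemma WellPosed.measurable_nextLevel (hwell : D.WellPosed)
    (hs : ∀ y ∈ Set.Icc (0 : ℝ) D.eMax, D.s y ∈ Set.Icc (0 : ℝ) 1) (e : Fin (D.eMax + 1))
    (b : Fin (D.bMax + 1)) : Measurable fun a : D.Action e => nextLevel e a b :=
  measurable_of_Ici fun n => (hwell.isClosed_le_nextLevel hs e b n).measurableSet

/-- Storing less of the arriving energy cannot raise the next battery level. -/
lemma WellPosed.nextLevel_antitone (hwell : D.WellPosed)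
    (hs : ∀ y ∈ Set.Icc (0 : ℝ) D.eMax, D.s y ∈ Set.Icc (0 : ℝ) 1) (e : Fin (D.eMax + 1))
    (ρ : Fin ((e : ℕ) + 1)) (b : Fin (D.bMax + 1)) {ι ι' : Set.Icc (0 : ℝ) 1} (h : ι ≤ ι') :
    nextLevel e (ρ, ι') b ≤ nextLevel e (ρ, ι) b := by
  have hle : netPower (ρ, ι') b ≤ netPower (ρ, ι) b := by
    have hb : (0 : ℝ) ≤ (b : ℕ) := Nat.cast_nonneg _
    have hι : (ι : ℝ) ≤ ι' := h
    unfold netPower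
    nlinarith
  have hF := (hwell.finalCharge_sub_mem hs e (netPower_mem_Icc (ρ, ι') b)
    (netPower_mem_Icc (ρ, ι) b) hle).1
  rw [le_nextLevel_iff]
  rcases le_nextLevel_iff.1 (le_refl (nextLevel e (ρ, ι') b)) with h0 | h0
  · exact Or.inl h0
  · exact Or.inr (h0.trans (by linarith))

/-- Finitely many power splitting parameters suffice: each parameter can be increased to one of
them without changing the next battery level. -/
lemma WellPosed.exists_finite_splitting (hwell : D.WellPosed)
    (hs : ∀ y ∈ Set.Icc (0 : ℝ) D.eMax, D.s y ∈ Set.Icc (0 : ℝ) 1) (e : Fin (D.eMax + 1)) :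
    ∃ A : Set (D.Action e), A.Finite ∧ ∀ ρ ι, ∃ ι', (ρ, ι') ∈ A ∧ ι ≤ ι' ∧
      ∀ b, nextLevel e (ρ, ι') b = nextLevel e (ρ, ι) b := by
  -- Lower bounds on the levels, unlike equalities, define closed sets. Equality at the greatest
  -- element is recovered below from antitonicity in `ι`.
  let U (ρ : Fin ((e : ℕ) + 1)) (n : Fin (D.bMax + 1) → Fin (D.eMax + 1)) :
      Set (Set.Icc (0 : ℝ) 1) := {ι | ∀ b, n b ≤ nextLevel e (ρ, ι) b}
  have hU : ∀ ρ n, ∃ m, (U ρ n).Nonempty → IsGreatest (U ρ n) m := fun ρ n => by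
    by_cases hne : (U ρ n).Nonempty
    · have hclosed : IsClosed (U ρ n) := by
        simp only [U, Set.ofPred_forall]
        exact isClosed_iInter fun b => (hwell.isClosed_le_nextLevel hs e b (n b)).preimage
          (Continuous.prodMk_right ρ)
      obtain ⟨m, hm⟩ := hclosed.isCompact.exists_isGreatest hne
      exact ⟨m, fun _ => hm⟩
    -- For an empty set the value is arbitrary; it only adds a superfluous action to `A`.
    · exact ⟨0, fun h => absurd h hne⟩
  choose m hm using hU
  refine ⟨Set.range fun q : Fin ((e : ℕ) + 1) × (Fin (D.bMax + 1) → Fin (D.eMax + 1)) =>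
    (q.1, m q.1 q.2), Set.finite_range _, fun ρ ι => ?_⟩
  have hmem : ι ∈ U ρ fun b => nextLevel e (ρ, ι) b := fun b => le_rfl
  have hgr := hm ρ _ ⟨ι, hmem⟩
  exact ⟨_, ⟨(ρ, fun b => nextLevel e (ρ, ι) b), rfl⟩, hgr.2 hmem, fun b =>
    le_antisymm (hwell.nextLevel_antitone hs e ρ b (hgr.2 hmem)) (hgr.1 b)⟩

/-! ### Policies as stochastic matrices, and their one-step lookahead. -/

lemma stateLaw_eq_pow (μ : D.Policy) (s₀ : D.State) (k : ℕ) (st : D.State) :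
    stateLaw μ s₀ k st = (Matrix.of (transitionProb μ) ^ k) s₀ st := by
  induction k generalizing st with
  | zero => simp [stateLaw, Matrix.one_apply, eq_comm]
  | succ k ih => simp [stateLaw, pow_succ, Matrix.mul_apply, ih]

lemma expectedReward_eq_mulVec (μ : D.Policy) (s₀ : D.State) (k : ℕ) :
    expectedReward μ s₀ k = (Matrix.of (transitionProb μ) ^ k).mulVec (slotReward μ) s₀ := by
  simp only [expectedReward, stateLaw_eq_pow, Matrix.mulVec, dotProduct]

lemma WellPosed.integral_nextLevel (hwell : D.WellPosed)
    (hs : ∀ y ∈ Set.Icc (0 : ℝ) D.eMax, D.s y ∈ Set.Icc (0 : ℝ) 1) {e : Fin (D.eMax + 1)}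
    (ν : Measure (D.Action e)) [IsProbabilityMeasure ν] (b : Fin (D.bMax + 1))
    (φ : Fin (D.eMax + 1) → ℝ) :
    ∫ a, φ (nextLevel e a b) ∂ν = ∑ e', ν.real {a | nextLevel e a b = e'} * φ e' := by
  have hN := hwell.measurable_nextLevel hs e b
  have : IsProbabilityMeasure (ν.map fun a => nextLevel e a b) :=
    Measure.isProbabilityMeasure_map hN.aemeasurable
  rw [← integral_map hN.aemeasurable (f := φ) (measurable_of_finite φ).aestronglyMeasurable,
    integral_fintype .of_finite]
  refine Finset.sum_congr rfl fun e' _ => ?_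
  rw [map_measureReal_apply hN (measurableSet_singleton e'), smul_eq_mul]
  rfl

lemma WellPosed.transitionProb_mem_rowStochastic (hwell : D.WellPosed)
    (hpB : D.pB ∈ stdSimplex ℝ (Fin (D.bMax + 1)))
    (hpH : D.pH ∈ stdSimplex ℝ (Fin (D.hMax + 1)))
    (hs : ∀ y ∈ Set.Icc (0 : ℝ) D.eMax, D.s y ∈ Set.Icc (0 : ℝ) 1) (μ : D.Policy) :
    Matrix.of (transitionProb μ) ∈ Matrix.rowStochastic ℝ D.State := by
  rw [Matrix.mem_rowStochastic_iff_sum]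
  refine ⟨fun st st' => mul_nonneg (Finset.sum_nonneg fun b _ =>
    mul_nonneg (hpB.1 b) measureReal_nonneg) (hpH.1 _), fun st => ?_⟩
  have hone : ∀ b, ∑ e', (μ st : Measure (D.Action st.1)).real {a | nextLevel st.1 a b = e'} = 1 :=
    fun b => by
      simpa using (hwell.integral_nextLevel hs (μ st : Measure (D.Action st.1)) b
        (fun _ => 1)).symm
  simp only [Matrix.of_apply, transitionProb, Fintype.sum_prod_type]
  simp_rw [← Finset.mul_sum, hpH.2, mul_one]
  rw [Finset.sum_comm]
  simp_rw [← Finset.mul_sum, hone, mul_one, hpB.2]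

/-- Reward of a slot with state `st` and action `a`, followed by a terminal reward `v`, averaged
over the energy arrival and over the next channel state. -/
noncomputable def lookahead (v : D.State → ℝ) (st : D.State) (a : D.Action st.1) : ℝ :=
  ∑ b, D.pB b * (D.g (((a.1 : ℕ) : ℝ) + (b : ℝ) * (a.2 : ℝ)) st.2 +
    ∑ h, D.pH h * v (nextLevel st.1 a b, h))

lemma transmitPower_nonneg {e : Fin (D.eMax + 1)} (a : D.Action e) (b : Fin (D.bMax + 1)) :
    0 ≤ ((a.1 : ℕ) : ℝ) + (b : ℝ) * (a.2 : ℝ) :=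
  add_nonneg (Nat.cast_nonneg _) (mul_nonneg (Nat.cast_nonneg _) a.2.2.1)

/-- Monotonicity of `g` gives everything: measurability in `ι` for each of the finitely many `ρ`,
and bounds by the values at `0` and `e + b`. -/
lemma integrable_reward (hmono : ∀ h, MonotoneOn (fun x => D.g x h) (Set.Ici 0))
    {e : Fin (D.eMax + 1)} (ν : Measure (D.Action e)) [IsProbabilityMeasure ν]
    (b : Fin (D.bMax + 1)) (h : Fin (D.hMax + 1)) :
    Integrable (fun a : D.Action e => D.g (((a.1 : ℕ) : ℝ) + (b : ℝ) * (a.2 : ℝ)) h) ν := by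
  have hb : (0 : ℝ) ≤ ((b : ℕ) : ℝ) := Nat.cast_nonneg _
  have hmeas : Measurable fun a : D.Action e =>
      D.g (((a.1 : ℕ) : ℝ) + (b : ℝ) * (a.2 : ℝ)) h := by
    refine measurable_from_prod_countable_right fun ρ => Monotone.measurable fun ι ι' hι => ?_
    refine hmono h (transmitPower_nonneg (ρ, ι) b) (transmitPower_nonneg (ρ, ι') b) ?_
    have : (ι : ℝ) ≤ ι' := hι
    gcongr
  refine Integrable.of_bound hmeas.aestronglyMeasurable
    (|D.g 0 h| + |D.g ((e : ℝ) + (b : ℝ)) h|) (Filter.Eventually.of_forall fun a => ?_)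
  have ha := transmitPower_nonneg a b
  have h1 := hmono h Set.self_mem_Ici ha ha
  have hle : ((a.1 : ℕ) : ℝ) + (b : ℝ) * (a.2 : ℝ) ≤ (e : ℝ) + (b : ℝ) :=
    add_le_add (by exact_mod_cast Nat.lt_succ_iff.1 a.1.2) (mul_le_of_le_one_right hb a.2.2.2)
  have h2 := hmono h ha (ha.trans hle) hle
  simp only at h1 h2
  rw [Real.norm_eq_abs, abs_le]
  constructor
  · linarith [neg_abs_le (D.g 0 h), abs_nonneg (D.g ((e : ℝ) + (b : ℝ)) h)]
  · linarith [le_abs_self (D.g ((e : ℝ) + (b : ℝ)) h), abs_nonneg (D.g 0 h)]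

lemma WellPosed.integrable_nextLevel (hwell : D.WellPosed)
    (hs : ∀ y ∈ Set.Icc (0 : ℝ) D.eMax, D.s y ∈ Set.Icc (0 : ℝ) 1) {e : Fin (D.eMax + 1)}
    (ν : Measure (D.Action e)) [IsProbabilityMeasure ν] (b : Fin (D.bMax + 1))
    (φ : Fin (D.eMax + 1) → ℝ) : Integrable (fun a => φ (nextLevel e a b)) ν := by
  refine Integrable.of_bound
    ((measurable_of_finite φ).comp (hwell.measurable_nextLevel hs e b)).aestronglyMeasurable
    ‖φ‖ (Filter.Eventually.of_forall fun a => norm_le_pi_norm φ _)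

lemma WellPosed.integrable_lookahead (hwell : D.WellPosed)
    (hs : ∀ y ∈ Set.Icc (0 : ℝ) D.eMax, D.s y ∈ Set.Icc (0 : ℝ) 1)
    (hmono : ∀ h, MonotoneOn (fun x => D.g x h) (Set.Ici 0)) (v : D.State → ℝ) (st : D.State)
    (ν : Measure (D.Action st.1)) [IsProbabilityMeasure ν] : Integrable (lookahead v st) ν :=
  integrable_finsetSum _ fun b _ => ((integrable_reward hmono ν b st.2).add
    (hwell.integrable_nextLevel hs ν b fun e' => ∑ h, D.pH h * v (e', h))).const_mul _

/-- This turns the lookahead of a randomized policy into an average over actions, so that a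
maximizing action dominates it. -/
lemma WellPosed.integral_lookahead (hwell : D.WellPosed)
    (hs : ∀ y ∈ Set.Icc (0 : ℝ) D.eMax, D.s y ∈ Set.Icc (0 : ℝ) 1)
    (hmono : ∀ h, MonotoneOn (fun x => D.g x h) (Set.Ici 0)) (μ : D.Policy) (v : D.State → ℝ)
    (st : D.State) :
    slotReward μ st + (Matrix.of (transitionProb μ)).mulVec v st =
      ∫ a, lookahead v st a ∂(μ st : Measure (D.Action st.1)) := by
  set ν := (μ st : Measure (D.Action st.1)) with hν
  set φ : Fin (D.eMax + 1) → ℝ := fun e' => ∑ h, D.pH h * v (e', h) with hφ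
  have hsum : ∀ b, Integrable (fun a : D.Action st.1 => D.pB b *
      (D.g (((a.1 : ℕ) : ℝ) + (b : ℝ) * (a.2 : ℝ)) st.2 + φ (nextLevel st.1 a b))) ν := fun b =>
    ((integrable_reward hmono ν b st.2).add (hwell.integrable_nextLevel hs ν b φ)).const_mul _
  have hint : ∫ a, lookahead v st a ∂ν = ∑ b, D.pB b *
      (∫ a, D.g (((a.1 : ℕ) : ℝ) + (b : ℝ) * (a.2 : ℝ)) st.2 ∂ν +
        ∑ e', ν.real {a | nextLevel st.1 a b = e'} * φ e') := by
    unfold lookahead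
    rw [integral_finsetSum _ fun b _ => hsum b]
    refine Finset.sum_congr rfl fun b _ => ?_
    rw [integral_const_mul, integral_add (integrable_reward hmono ν b st.2)
      (hwell.integrable_nextLevel hs ν b φ), hwell.integral_nextLevel hs ν b φ]
  rw [hint]
  simp only [mul_add, Finset.sum_add_distrib]
  congr 1
  simp only [Matrix.mulVec, dotProduct, Matrix.of_apply, transitionProb, Fintype.sum_prod_type,
    hφ, Finset.mul_sum, Finset.sum_mul, ← hν]
  conv_rhs => rw [Finset.sum_comm]
  refine Finset.sum_congr rfl fun e' _ => ?_
  rw [Finset.sum_comm]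
  exact Finset.sum_congr rfl fun b _ => Finset.sum_congr rfl fun h _ => by ring

/-- Increasing the power splitting parameter without changing the next battery level does not
decrease the lookahead. -/
lemma lookahead_le_of_nextLevel_eq
    (hpB : D.pB ∈ stdSimplex ℝ (Fin (D.bMax + 1)))
    (hmono : ∀ h, MonotoneOn (fun x => D.g x h) (Set.Ici 0)) (v : D.State → ℝ) (st : D.State)
    {ρ : Fin ((st.1 : ℕ) + 1)} {ι ι' : Set.Icc (0 : ℝ) 1} (hι : ι ≤ ι')
    (hnext : ∀ b, nextLevel st.1 (ρ, ι') b = nextLevel st.1 (ρ, ι) b) :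
    lookahead v st (ρ, ι) ≤ lookahead v st (ρ, ι') := by
  refine Finset.sum_le_sum fun b _ => mul_le_mul_of_nonneg_left ?_ (hpB.1 b)
  rw [hnext b]
  refine add_le_add_left (hmono st.2 (transmitPower_nonneg (ρ, ι) b)
    (transmitPower_nonneg (ρ, ι') b) ?_) _
  have : (ι : ℝ) ≤ ι' := hι
  gcongr

end HarvestingDevice

theorem theorem1 (D : HarvestingDevice)
    (hpB : D.pB ∈ stdSimplex ℝ (Fin (D.bMax + 1)))
    (hpH : D.pH ∈ stdSimplex ℝ (Fin (D.hMax + 1)))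
    (hs : ∀ y ∈ Set.Icc (0 : ℝ) D.eMax, D.s y ∈ Set.Icc (0 : ℝ) 1)
    (hwell : D.WellPosed)
    (hmono : ∀ h, MonotoneOn (fun x => D.g x h) (Set.Ici 0))
    (hconc : ∀ h, ConcaveOn ℝ (Set.Ici 0) (fun x => D.g x h)) :
    ∃ (ρ : ∀ st : D.State, Fin ((st.1 : ℕ) + 1)) (ι : D.State → Set.Icc (0 : ℝ) 1),
      ∀ (μ : D.Policy) (s₀ : D.State),
        HarvestingDevice.averageReward μ s₀ ≤
          HarvestingDevice.averageReward (HarvestingDevice.deterministicPolicy ρ ι) s₀ := by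
  choose A hAfin hA using fun st : D.State => hwell.exists_finite_splitting hs st.1
  let det (q : ∀ st : D.State, D.Action st.1) : D.Policy :=
    HarvestingDevice.deterministicPolicy (fun st => (q st).1) fun st => (q st).2
  have hfin : (det '' Set.univ.pi A).Finite := (Set.Finite.pi hAfin).image det
  obtain ⟨_, ⟨q, -, rfl⟩, hopt⟩ := exists_average_optimal (S := D.State) (M := D.Policy)
    HarvestingDevice.slotReward (fun μ => Matrix.of (HarvestingDevice.transitionProb μ))
    (hwell.transitionProb_mem_rowStochastic hpB hpH hs) hfin fun v => by
      have hmax : ∀ st, ∃ a ∈ A st, ∀ a',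
          HarvestingDevice.lookahead v st a' ≤ HarvestingDevice.lookahead v st a := fun st => by
        -- Any pair, here `(0, 0)`, yields an element of `A st`, so the maximum is over a nonempty
        -- set.
        obtain ⟨ι₀, hι₀, -⟩ := hA st 0 0
        obtain ⟨a, ha, hle⟩ := Set.exists_max_image (A st) (HarvestingDevice.lookahead v st)
          (hAfin st) ⟨_, hι₀⟩
        refine ⟨a, ha, fun ⟨ρ, ι⟩ => ?_⟩
        obtain ⟨ι', hmem, hι, hnext⟩ := hA st ρ ι
        exact (HarvestingDevice.lookahead_le_of_nextLevel_eq hpB hmono v st hι hnext).trans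
          (hle _ hmem)
      choose q hqA hq using hmax
      refine ⟨det q, ⟨q, fun st _ => hqA st, rfl⟩, fun μ st => ?_⟩
      rw [hwell.integral_lookahead hs hmono, hwell.integral_lookahead hs hmono]
      have hdet : ∫ a, HarvestingDevice.lookahead v st a ∂(det q st : Measure (D.Action st.1)) =
          HarvestingDevice.lookahead v st (q st) := integral_dirac _ _
      rw [hdet]
      calc ∫ a, HarvestingDevice.lookahead v st a ∂(μ st : Measure (D.Action st.1))
          ≤ ∫ _, HarvestingDevice.lookahead v st (q st) ∂(μ st : Measure (D.Action st.1)) :=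
            integral_mono (hwell.integrable_lookahead hs hmono v st _) (integrable_const _) (hq st)
        _ = HarvestingDevice.lookahead v st (q st) := by simp
  refine ⟨fun st => (q st).1, fun st => (q st).2, fun μ s₀ => ?_⟩
  simp only [HarvestingDevice.averageReward, HarvestingDevice.expectedReward_eq_mulVec]
  exact hopt μ s₀
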